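/- For $0<\alpha<\pi/2$ let $S_\alpha=\{z\in\mathbb C:\operatorname{Re}z>0,\ |\arg z|<\alpha\}$. Let $\mu$ be a complex Borel measure on $\mathbb C$ that is supported on a compact subset of $S_\alpha$, is symmetric, i.e. $\mu(\overline E)=\overline{\mu(E)}$ for every Borel set $E$ (where $\overline E=\{\overline z: z\in E\}$), and has total mass $\int d\mu=0$. Let $F(z)=\int e^{-z\xi}\,d\mu(\xi)$ be its Fourier--Borel transform. Let $\mathcal B$ be a complex Banach algebra with identity (for instance the algebra of bounded operators on a Banach space), and let $T=(T(z))_{z\in S_\alpha}$ be an analytic semigroup in $\mathcal B$, i.e. a holomorphic map $T:S_\alpha\to\mathcal B$ with $T(z+w)=T(z)T(w)$ for all $z,w\in S_\alpha$ (nothing is assumed about the behaviour at $0$). Suppose that $T$ is non-quasinilpotent, i.e. that the spectral radius $\rho(T(z))$ is non-zero for some $z\in S_\alpha$. Let $\mathcal A_T$ be the closed (not necessarily unital) subalgebra of $\mathcal B$ generated by $\{T(z):z\in S_\alpha\}$, let $\operatorname{rad}\mathcal A_T$ be its Jacobson radical, and let $\pi:\mathcal A_T\to\mathcal A_T/\operatorname{rad}\mathcal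 A_T$ be the canonical surjection. For real $t>0$ put $$F(-tA)=\int T(t\xi)\,d\mu(\xi)\in\mathcal B .$$ **Theorem.** If there is $t_0>0$ such that $$\rho\bigl(F(-tA)\bigr)<\sup_{x>0}|F(x)|\qquad\text{for all real } t \text{ with } 0<t\le t_0,$$ then $\mathcal A_T/\operatorname{rad}\mathcal A_T$ is unital (it has a non-zero identity element), and the generator of the semigroup $(\pi(T(t)))_{t>0}$, acting by multiplication on the Banach algebra $\mathcal A_T/\operatorname{rad}\mathcal A_T$, is bounded: the limit $\lim_{t\to0+}t^{-1}\bigl(\pi(T(t))x-x\bigr)$ exists for every $x\in\mathcal A_T/\operatorname{rad}\mathcal A_T$ and defines a bounded linear operator on this algebra. -/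

import Mathlib

open MeasureTheory Filter Topology Set

noncomputable section

namespace SectorSemigroup

/-- The open sector `S_α = {z : Re z > 0, |arg z| < α}`. -/
def sector (α : ℝ) : Set ℂ := {z | 0 < z.re ∧ |z.arg| < α}

lemma ofReal_mem_sector {α : ℝ} (hα : 0 < α) {t : ℝ} (ht : 0 < t) : (t : ℂ) ∈ sector α := by
  refine ⟨by simpa using ht, ?_⟩
  rw [Complex.arg_ofReal_of_nonneg ht.le]
  simpa using hα

/-! ### Complex measures and the functional calculus -/

/-- The integral `∫ f dμ` of a Banach-space-valued function against a complex measure. -/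
def cintegral {E : Type*} [NormedAddCommGroup E] [NormedSpace ℂ E]
    (μ : ComplexMeasure ℂ) (f : ℂ → E) : E :=
  μ.integral f (ContinuousLinearMap.lsmul ℝ ℂ : ℂ →L[ℝ] E →L[ℝ] E).flip

/-- `μ` is supported on a compact subset of `S_α`. -/
def IsCompactlySupportedIn (μ : ComplexMeasure ℂ) (α : ℝ) : Prop :=
  ∃ K : Set ℂ, IsCompact K ∧ K ⊆ sector α ∧
    ∀ E : Set ℂ, MeasurableSet E → Disjoint E K → μ E = 0

/-- `μ` of the conjugate of a set is the conjugate of `μ` of the set. -/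
def IsSymmetricMeasure (μ : ComplexMeasure ℂ) : Prop :=
  ∀ E : Set ℂ, MeasurableSet E → μ (starRingEnd ℂ '' E) = starRingEnd ℂ (μ E)

/-- The Fourier-Borel transform `F(z) = ∫ e^{-zξ} dμ(ξ)`. -/
def fourierBorel (μ : ComplexMeasure ℂ) (z : ℂ) : ℂ :=
  cintegral μ fun ξ => Complex.exp (-(z * ξ))

section Algebra

variable {B : Type*} [NormedRing B] [NormedAlgebra ℂ B]

/-- An analytic semigroup on `S_α` in the Banach algebra `B`; only the values on the sector
matter, and no behaviour at `0` is prescribed. -/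
structure IsAnalyticSemigroup (α : ℝ) (T : ℂ → B) : Prop where
  map_add : ∀ z ∈ sector α, ∀ w ∈ sector α, T (z + w) = T z * T w
  differentiableOn : DifferentiableOn ℂ T (sector α)

/-- All elements of the semigroup have spectral radius zero. -/
def IsQuasinilpotentSemigroup (α : ℝ) (T : ℂ → B) : Prop :=
  ∀ z ∈ sector α, spectralRadius ℂ (T z) = 0

/-- `F(-uA) = ∫ T(uξ) dμ(ξ)`, where `F` is the Fourier-Borel transform of `μ` and `A` is the
generator of `T`. -/
def functionalCalculus (μ : ComplexMeasure ℂ) (T : ℂ → B) (u : ℂ) : B :=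
  cintegral μ fun ξ => T (u * ξ)

/-- The closed (not necessarily unital) subalgebra of `B` generated by `T(z)`, `z ∈ S_α`. -/
def semigroupAlgebra (α : ℝ) (T : ℂ → B) : NonUnitalSubalgebra ℂ B :=
  (NonUnitalAlgebra.adjoin ℂ (T '' sector α)).topologicalClosure

lemma mem_semigroupAlgebra {α : ℝ} (T : ℂ → B) {z : ℂ} (hz : z ∈ sector α) :
    T z ∈ semigroupAlgebra α T :=
  NonUnitalSubalgebra.le_topologicalClosure _
    (NonUnitalAlgebra.subset_adjoin ℂ (mem_image_of_mem T hz))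

instance (α : ℝ) (T : ℂ → B) [CompleteSpace B] : CompleteSpace (semigroupAlgebra α T) :=
  (NonUnitalSubalgebra.isClosed_topologicalClosure
    (NonUnitalAlgebra.adjoin ℂ (T '' sector α))).completeSpace_coe

instance (α : ℝ) (T : ℂ → B) : NormedSpace ℂ (semigroupAlgebra α T) where
  norm_smul_le c x := norm_smul_le c (x : B)

/-- `T(t)`, `t > 0`, as an element of the algebra generated by the semigroup. -/
def semigroupElement {α : ℝ} (hα : 0 < α) (T : ℂ → B) (t : Ioi (0 : ℝ)) : semigroupAlgebra α T :=
  ⟨T ((t : ℝ) : ℂ), mem_semigroupAlgebra T (ofReal_mem_sector hα t.2)⟩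

end Algebra

/-! ### The radical and the quotient by the radical -/

section Radical

variable (A : Type*) [NonUnitalNormedRing A] [NormedSpace ℂ A] [IsScalarTower ℂ A A]
  [SMulCommClass ℂ A A]

/-- The Jacobson radical of a Banach algebra `A` that need not have an identity:
`rad A = A ∩ rad A^#`, where `A^# = ℂ ⊕ A` is the unitization. -/
def radical : Submodule ℂ A where
  carrier := {a | (a : Unitization ℂ A) ∈ Ring.jacobson (Unitization ℂ A)}
  add_mem' {a b} ha hb := by
    change ((a + b : A) : Unitization ℂ A) ∈ Ring.jacobson (Unitization ℂ A)
    rw [Unitization.inr_add]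
    exact add_mem ha hb
  zero_mem' := by simp
  smul_mem' c a ha := by
    have h := (Ring.jacobson (Unitization ℂ A)).mul_mem_left (algebraMap ℂ _ c) ha
    rw [← Algebra.smul_def, ← Unitization.inr_smul] at h
    exact h

variable {A}

lemma mem_radical {a : A} :
    a ∈ radical A ↔ (a : Unitization ℂ A) ∈ Ring.jacobson (Unitization ℂ A) := Iff.rfl

lemma mul_mem_radical_left (a : A) {b : A} (hb : b ∈ radical A) : a * b ∈ radical A := by
  rw [mem_radical, Unitization.inr_mul]
  exact (Ring.jacobson (Unitization ℂ A)).mul_mem_left _ hb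

lemma mul_mem_radical_right {a : A} (b : A) (ha : a ∈ radical A) : a * b ∈ radical A := by
  rw [mem_radical, Unitization.inr_mul]
  exact Ideal.mul_mem_right _ _ ha

instance isClosed_radical [CompleteSpace A] : IsClosed (radical A : Set A) := by
  let e := WithLp.unitizationAlgEquiv (𝕜 := ℂ) (A := A) ℂ
  have key : (radical A : Set A) = ⋂ (m : Ideal (Unitization ℂ A)) (_ : m.IsMaximal),
      (fun x : A => WithLp.toLp 1 (x : Unitization ℂ A)) ⁻¹' (m.comap e : Set _) := by
    ext x
    simp only [SetLike.mem_coe, mem_radical, Ring.jacobson, Module.jacobson, Submodule.mem_sInf,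
      mem_iInter, mem_preimage]
    exact ⟨fun h m hm => h m hm.out, fun h m hm => h m ⟨hm⟩⟩
  rw [key]
  refine isClosed_iInter fun m => isClosed_iInter fun hm => ?_
  have : (m.comap e).IsMaximal := Ideal.comap_isMaximal_of_equiv e
  exact (Ideal.IsMaximal.isClosed (I := m.comap e)).preimage
    WithLp.unitization_isometry_inr.continuous

/-- Multiplication of `A ⧸ rad A`. -/
instance : Mul (A ⧸ radical A) where
  mul := Quotient.map₂ (· * ·) (by
    intro a a' ha b b' hb
    have ha : a - a' ∈ radical A := (Submodule.quotientRel_def _).1 ha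
    have hb : b - b' ∈ radical A := (Submodule.quotientRel_def _).1 hb
    refine (Submodule.quotientRel_def _).2 ?_
    have : a * b - a' * b' = a * (b - b') + (a - a') * b' := by noncomm_ring
    rw [this]
    exact add_mem (mul_mem_radical_left _ hb) (mul_mem_radical_right _ ha))

lemma mk_mul (a b : A) :
    (Submodule.Quotient.mk (a * b) : A ⧸ radical A)
      = Submodule.Quotient.mk a * Submodule.Quotient.mk b := rfl

instance : NonUnitalRing (A ⧸ radical A) where
  left_distrib := by
    rintro ⟨a⟩ ⟨b⟩ ⟨c⟩
    exact congrArg Submodule.Quotient.mk (mul_add a b c)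
  right_distrib := by
    rintro ⟨a⟩ ⟨b⟩ ⟨c⟩
    exact congrArg Submodule.Quotient.mk (add_mul a b c)
  zero_mul := by
    rintro ⟨a⟩
    exact congrArg Submodule.Quotient.mk (zero_mul a)
  mul_zero := by
    rintro ⟨a⟩
    exact congrArg Submodule.Quotient.mk (mul_zero a)
  mul_assoc := by
    rintro ⟨a⟩ ⟨b⟩ ⟨c⟩
    exact congrArg Submodule.Quotient.mk (mul_assoc a b c)

instance : IsScalarTower ℂ (A ⧸ radical A) (A ⧸ radical A) where
  smul_assoc := by
    rintro c ⟨a⟩ ⟨b⟩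
    exact congrArg Submodule.Quotient.mk (smul_mul_assoc c a b)

instance : SMulCommClass ℂ (A ⧸ radical A) (A ⧸ radical A) where
  smul_comm := by
    rintro c ⟨a⟩ ⟨b⟩
    exact congrArg Submodule.Quotient.mk (mul_smul_comm c a b).symm

end Radical

/-! ### Generators -/

/-- The algebra has a (non-zero) identity element. -/
def IsUnital (R : Type*) [NonUnitalRing R] : Prop :=
  ∃ e : R, e ≠ 0 ∧ ∀ x : R, e * x = x ∧ x * e = x

section Generator

variable {E : Type*} [NormedAddCommGroup E] [NormedSpace ℂ E]

/-- `y = lim_{t → 0+} (U(t) x - x) / t`. -/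
def HasGeneratorValue (U : Ioi (0 : ℝ) → E →ₗ[ℂ] E) (x y : E) : Prop :=
  Tendsto (fun t : Ioi (0 : ℝ) => (((t : ℝ) : ℂ)⁻¹) • (U t x - x))
    (comap Subtype.val (𝓝 (0 : ℝ))) (𝓝 y)

instance : (comap (Subtype.val : Ioi (0 : ℝ) → ℝ) (𝓝 (0 : ℝ))).NeBot := by
  rw [← mem_closure_iff_comap_neBot, closure_Ioi]
  exact self_mem_Ici

lemma HasGeneratorValue.unique {U : Ioi (0 : ℝ) → E →ₗ[ℂ] E} {x y y' : E}
    (h : HasGeneratorValue U x y) (h' : HasGeneratorValue U x y') : y = y' :=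
  tendsto_nhds_unique h h'

lemma HasGeneratorValue.add {U : Ioi (0 : ℝ) → E →ₗ[ℂ] E} {x y x' y' : E}
    (h : HasGeneratorValue U x y) (h' : HasGeneratorValue U x' y') :
    HasGeneratorValue U (x + x') (y + y') := by
  refine (Tendsto.add h h').congr fun t => ?_
  rw [← smul_add, map_add]
  congr 1
  abel

lemma HasGeneratorValue.smul {U : Ioi (0 : ℝ) → E →ₗ[ℂ] E} {x y : E} (c : ℂ)
    (h : HasGeneratorValue U x y) : HasGeneratorValue U (c • x) (c • y) := by
  refine (Tendsto.const_smul h c).congr fun t => ?_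
  rw [smul_comm, smul_sub, map_smul]

/-- The infinitesimal generator of the semigroup `(U(t))_{t > 0}` of operators on `E`: the
operator `x ↦ lim_{t → 0+} (U(t) x - x) / t`, whose domain consists of all `x` for which the
limit exists. -/
def generator (U : Ioi (0 : ℝ) → E →ₗ[ℂ] E) : E →ₗ.[ℂ] E where
  domain :=
    { carrier := {x | ∃ y, HasGeneratorValue U x y}
      add_mem' := fun ⟨_, h⟩ ⟨_, h'⟩ => ⟨_, h.add h'⟩
      zero_mem' := ⟨0, by simp [HasGeneratorValue]⟩
      smul_mem' := fun c _ ⟨_, h⟩ => ⟨_, h.smul c⟩ }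
  toFun :=
    { toFun := fun x => x.2.choose
      map_add' := fun x x' =>
        (x + x').2.choose_spec.unique (x.2.choose_spec.add x'.2.choose_spec)
      map_smul' := fun c x => (c • x).2.choose_spec.unique (x.2.choose_spec.smul c) }

/-- A bounded everywhere defined operator. -/
def IsBoundedOperator (G : E →ₗ.[ℂ] E) : Prop :=
  G.domain = ⊤ ∧ ∃ C : ℝ, ∀ x : G.domain, ‖G x‖ ≤ C * ‖(x : E)‖

end Generator

/-- The semigroup `(π(T(t)))_{t > 0}`, acting by multiplication on `𝒜_T ⧸ rad 𝒜_T`, where `π` is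
the canonical surjection of `𝒜_T` onto `𝒜_T ⧸ rad 𝒜_T`. -/
def quotientSemigroup {B : Type*} [NormedRing B] [NormedAlgebra ℂ B] {α : ℝ} (hα : 0 < α)
    (T : ℂ → B) (t : Ioi (0 : ℝ)) :
    (semigroupAlgebra α T ⧸ radical (semigroupAlgebra α T)) →ₗ[ℂ]
      (semigroupAlgebra α T ⧸ radical (semigroupAlgebra α T)) :=
  LinearMap.mulLeft ℂ ((radical (semigroupAlgebra α T)).mkQ (semigroupElement hα T t))

end SectorSemigroup

end

noncomputable section

namespace SectorSemigroup

/-! ### Integration against complex measures -/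

section VectorIntegral

variable {X E E' F F' G G' : Type*} [MeasurableSpace X]
  [NormedAddCommGroup E] [NormedSpace ℝ E] [NormedAddCommGroup E'] [NormedSpace ℝ E']
  [NormedAddCommGroup F] [NormedSpace ℝ F] [NormedAddCommGroup F'] [NormedSpace ℝ F']
  [NormedAddCommGroup G] [NormedSpace ℝ G] [NormedAddCommGroup G'] [NormedSpace ℝ G']

/-! The algebra `𝒜_T` is commutative, so by Gelfand theory everything modulo the radical is decided
by the characters `φ` of its unitization (`mem_radical_iff_forall_algHom`). Each `φ ∘ T` is a scalar
holomorphic semigroup, hence zero or `z ↦ exp (-λ z)` (`eq_zero_or_exists_eq_exp`). The heart of the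
matter is that the exponents `λ` form a bounded set.

Applying `φ` to `F(-tA)` gives `F(tλ)`, so the hypothesis forces `|F(tλ)| < sup |F|` for `0 < t ≤
t₀`. Since `|φ(T(1 ± iκ))| ≤ ‖T(1 ± iκ)‖`, all `λ` lie in a translate of a cone about the positive
axis on which `F` decays. If `λ` is far out in it, consider the triangle cut from the cone between
the rays through `λ` and its conjugate by a distant vertical line. There `|F|` stays below its
maximum over the positive axis on every side: by hypothesis on the long initial segment of one ray,
by symmetry on the other, by decay far out, and at the apex because `F(0) = 0`. This contradicts the
maximum principle (`exists_le_norm_of_mem_cone`, `exists_bound_of_fourierBorel_lt`).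

With `|λ| ≤ R`, for small `s` the spectrum of `T(s)` lies in `{0}` and a disc about `1`. A Cauchy
integral then yields `b` inverting `T(s)` on all characters that do not vanish on `𝒜_T`, so that
modulo the radical `T(s) b` is the identity and `T'(s) b` is the generator
(`exists_one_and_derivative`). -/

lemma integral_indicator_const [CompleteSpace G] (μ : VectorMeasure X F)
    (B : E →L[ℝ] F →L[ℝ] G) {s : Set X} (hs : MeasurableSet s) (hμs : μ.variation s ≠ ⊤) (c : E) :
    μ.integral (s.indicator fun _ => c) B = B c (μ s) := by
  rw [VectorMeasure.integral_eq_setToFun, setToFun_indicator_const _ hs hμs]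
  rfl

/-- Continuous linear maps intertwining two pairings commute with the integrals. -/
lemma map_integral_eq_integral_map [CompleteSpace G] [CompleteSpace G']
    {μ : VectorMeasure X F} {ν : VectorMeasure X F'} (hν : ν.variation = μ.variation)
    {B : E →L[ℝ] F →L[ℝ] G} {B' : E' →L[ℝ] F' →L[ℝ] G'} (L : G →L[ℝ] G') (M : E →L[ℝ] E')
    (hL : ∀ x s, MeasurableSet s → L (B x (μ s)) = B' (M x) (ν s)) {f : X → E}
    (hf : Integrable f μ.variation) :
    L (μ.integral f B) = ν.integral (fun x => M (f x)) B' := by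
  refine Integrable.induction
    (fun f => L (μ.integral f B) = ν.integral (fun x => M (f x)) B') ?_ ?_ ?_ ?_ hf
  · intro c s hs hμs
    rw [integral_indicator_const μ B hs hμs.ne, hL c s hs,
      ← integral_indicator_const ν B' hs (by rw [hν]; exact hμs.ne)]
    congr 1
    ext x
    by_cases hx : x ∈ s <;> simp [hx]
  · intro f g _ hf hg ihf ihg
    rw [VectorMeasure.integral_add hf hg, map_add, ihf, ihg,
      ← VectorMeasure.integral_add (by rw [VectorMeasure.Integrable, hν]; exact M.integrable_comp hf)
        (by rw [VectorMeasure.Integrable, hν]; exact M.integrable_comp hg)]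
    congr 1
    ext x
    simp
  · have h1 : Continuous fun f : X →₁[μ.variation] E => L (μ.integral f B) :=
      L.continuous.comp VectorMeasure.continuous_integral
    -- Equal variations let both integrals be viewed on the same `L¹` space, where density of simple
    -- functions applies.
    have h2 : Continuous fun f : X →₁[μ.variation] E' => ν.integral f B' := by
      rw [← hν]
      exact VectorMeasure.continuous_integral
    have h3 : Continuous fun f : X →₁[μ.variation] E => ν.integral (fun x => M (f x)) B' := by
      refine (h2.comp (M.compLpL 1 μ.variation).continuous).congr fun f => ?_
      refine VectorMeasure.integral_congr_ae ?_
      rw [hν]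
      exact M.coeFn_compLpL f
    exact isClosed_eq h1 h3
  · intro f g hfg _ ih
    rw [← VectorMeasure.integral_congr_ae hfg, ih]
    refine VectorMeasure.integral_congr_ae ?_
    rw [hν]
    filter_upwards [hfg] with x hx
    rw [hx]

end VectorIntegral

/-- The variation is dominated by the sum of the total variations of the real and imaginary parts,
both finite. -/
instance isFiniteMeasure_variation {X : Type*} [MeasurableSpace X] (μ : ComplexMeasure X) :
    IsFiniteMeasure μ.variation := by
  have h : μ.variation ≤ (ComplexMeasure.re μ).totalVariation
      + (ComplexMeasure.im μ).totalVariation := by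
    refine VectorMeasure.variation_le_of_forall_enorm_le fun E _ => ?_
    rw [Measure.add_apply]
    calc ‖μ E‖ₑ = ‖((μ E).re : ℂ) + ((μ E).im : ℂ) * Complex.I‖ₑ := by rw [Complex.re_add_im]
      _ ≤ ‖((μ E).re : ℂ)‖ₑ + ‖((μ E).im : ℂ) * Complex.I‖ₑ := enorm_add_le _ _
      _ = ‖(μ E).re‖ₑ + ‖(μ E).im‖ₑ := by simp [← ofReal_norm]
      _ ≤ _ := add_le_add (SignedMeasure.enorm_le_totalVariation (ComplexMeasure.re μ) E)
        (SignedMeasure.enorm_le_totalVariation (ComplexMeasure.im μ) E)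
  exact isFiniteMeasure_of_le _ h

section CIntegral

variable {E E' : Type*} [NormedAddCommGroup E] [NormedSpace ℂ E]
  [NormedAddCommGroup E'] [NormedSpace ℂ E'] {μ : ComplexMeasure ℂ} {K : Set ℂ}

lemma map_cintegral [CompleteSpace E] [CompleteSpace E'] (L : E →L[ℂ] E') {f : ℂ → E}
    (hf : Integrable f μ.variation) : L (cintegral μ f) = cintegral μ fun x => L (f x) :=
  map_integral_eq_integral_map rfl (L.restrictScalars ℝ) (L.restrictScalars ℝ)
    (fun x s _ => by simp) hf

lemma ae_mem_of_forall_disjoint (hK : IsCompact K)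
    (hμ : ∀ E : Set ℂ, MeasurableSet E → Disjoint E K → μ E = 0) : ∀ᵐ x ∂μ.variation, x ∈ K := by
  rw [ae_iff]
  refine (VectorMeasure.variation_apply_eq_zero hK.measurableSet.compl).2 fun t ht hm => ?_
  exact hμ t hm (disjoint_left.2 fun x hx => ht hx)

omit [NormedSpace ℂ E] in
lemma integrable_of_continuousOn (hK : IsCompact K) (hμ : ∀ᵐ x ∂μ.variation, x ∈ K) {f : ℂ → E}
    (hf : ContinuousOn f K) : Integrable f μ.variation := by
  have h : IntegrableOn f K μ.variation := hf.integrableOn_compact hK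
  rwa [IntegrableOn, Measure.restrict_eq_self_of_ae_mem hμ] at h

lemma norm_cintegral_le_of_norm_le {f : ℂ → ℂ} {c : ℝ} (h : ∀ᵐ x ∂μ.variation, ‖f x‖ ≤ c) :
    ‖cintegral μ f‖ ≤ c * (‖(ContinuousLinearMap.lsmul ℝ ℂ : ℂ →L[ℝ] ℂ →L[ℝ] ℂ).flip‖
      * μ.variation.real univ) := by
  rw [← mul_assoc]
  exact VectorMeasure.norm_integral_le_of_norm_le_const h

/-- Symmetry says that the image `ν` of `μ` under conjugation is the conjugate of `μ`. Conjugating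
values preserves the variation, so conjugation can be moved inside the integral and then turned into
a change of variables. -/
lemma conj_cintegral (hsymm : IsSymmetricMeasure μ) {f : ℂ → ℂ} (hf : Integrable f μ.variation) :
    starRingEnd ℂ (cintegral μ f)
      = cintegral μ fun x => starRingEnd ℂ (f (starRingEnd ℂ x)) := by
  let e : ℂ ≃ᵐ ℂ := Complex.conjCLE.toHomeomorph.toMeasurableEquiv
  let ν : ComplexMeasure ℂ := μ.map e
  have he : ∀ x, e x = starRingEnd ℂ x := fun _ => rfl
  have hν_apply : ∀ s, MeasurableSet s → ν s = starRingEnd ℂ (μ s) := by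
    intro s hs
    rw [VectorMeasure.map_apply _ e.measurable hs, ← hsymm s hs]
    congr 1
    ext x
    simp only [mem_preimage, mem_image, he]
    exact ⟨fun h => ⟨_, h, by simp⟩, by rintro ⟨y, hy, rfl⟩; simpa using hy⟩
  have hν : ν.variation = μ.variation := by
    refine le_antisymm ?_ ?_ <;> refine VectorMeasure.variation_le_of_forall_enorm_le fun s hs => ?_
    · rw [hν_apply s hs, ← ofReal_norm, RCLike.norm_conj, ofReal_norm]
      exact VectorMeasure.enorm_measure_le_variation μ s
    · refine le_trans (le_of_eq ?_) (VectorMeasure.enorm_measure_le_variation ν s)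
      rw [hν_apply s hs, ← ofReal_norm, ← ofReal_norm, RCLike.norm_conj]
  have h1 := map_integral_eq_integral_map hν
    (B := (ContinuousLinearMap.lsmul ℝ ℂ : ℂ →L[ℝ] ℂ →L[ℝ] ℂ).flip)
    (B' := (ContinuousLinearMap.lsmul ℝ ℂ : ℂ →L[ℝ] ℂ →L[ℝ] ℂ).flip)
    (Complex.conjCLE : ℂ →L[ℝ] ℂ) (Complex.conjCLE : ℂ →L[ℝ] ℂ)
    (fun x s hs => by simp [hν_apply s hs]) hf
  have h2 := VectorMeasure.integral_map_equiv (μ := μ)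
    (B := (ContinuousLinearMap.lsmul ℝ ℂ : ℂ →L[ℝ] ℂ →L[ℝ] ℂ).flip) e
    (fun x => (Complex.conjCLE : ℂ →L[ℝ] ℂ) (f x))
  exact h1.trans h2

end CIntegral

/-! ### The Fourier-Borel transform -/

section FourierBorel

variable {μ : ComplexMeasure ℂ} {K : Set ℂ}

lemma integrable_exp (hK : IsCompact K) (hμ : ∀ᵐ x ∂μ.variation, x ∈ K) (z : ℂ) :
    Integrable (fun ξ => Complex.exp (-(z * ξ))) μ.variation :=
  integrable_of_continuousOn hK hμ (by fun_prop)

lemma fourierBorel_conj (hK : IsCompact K) (hμ : ∀ᵐ x ∂μ.variation, x ∈ K)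
    (hsymm : IsSymmetricMeasure μ) (z : ℂ) :
    fourierBorel μ (starRingEnd ℂ z) = starRingEnd ℂ (fourierBorel μ z) := by
  rw [fourierBorel, fourierBorel, conj_cintegral hsymm (integrable_exp hK hμ z)]
  congr 1
  ext ξ
  rw [← Complex.exp_conj]
  simp

lemma fourierBorel_zero (hmass : μ univ = 0) : fourierBorel μ 0 = 0 := by
  have h : (fun ξ : ℂ => Complex.exp (-(0 * ξ))) = univ.indicator fun _ => 1 := by
    ext ξ; simp
  rw [fourierBorel, cintegral, h, integral_indicator_const _ _ MeasurableSet.univ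
    (measure_ne_top _ _), hmass, map_zero]

lemma norm_fourierBorel_le {z : ℂ} {c : ℝ} (hμ : ∀ᵐ ξ ∂μ.variation, c ≤ (z * ξ).re) :
    ‖fourierBorel μ z‖ ≤ Real.exp (-c) *
      (‖(ContinuousLinearMap.lsmul ℝ ℂ : ℂ →L[ℝ] ℂ →L[ℝ] ℂ).flip‖ * μ.variation.real univ) := by
  refine norm_cintegral_le_of_norm_le ?_
  filter_upwards [hμ] with ξ hξ
  rw [Complex.norm_exp, Complex.neg_re]
  gcongr

lemma differentiable_fourierBorel (hK : IsCompact K) (hμ : ∀ᵐ x ∂μ.variation, x ∈ K) :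
    Differentiable ℂ (fourierBorel μ) := by
  intro z
  obtain ⟨R, hR⟩ := hK.isBounded.exists_norm_le
  have hderiv : ∀ ξ w : ℂ, HasDerivAt (fun w => Complex.exp (-(w * ξ)))
      (Complex.exp (-(w * ξ)) * -ξ) w := fun ξ w => by
    have := ((hasDerivAt_id w).mul_const ξ).neg.cexp
    simpa using this
  have key : HasDerivAt (fourierBorel μ) (cintegral μ fun ξ => Complex.exp (-(z * ξ)) * -ξ) z := by
    rw [hasDerivAt_iff_tendsto_slope]
    have hslope : ∀ w, slope (fourierBorel μ) z w
        = cintegral μ fun ξ => slope (fun w => Complex.exp (-(w * ξ))) z w := by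
      intro w
      have h1 : fourierBorel μ w - fourierBorel μ z
          = cintegral μ (fun ξ => Complex.exp (-(w * ξ)) - Complex.exp (-(z * ξ))) :=
        (VectorMeasure.integral_fun_sub (integrable_exp hK hμ w) (integrable_exp hK hμ z)).symm
      have h2 := map_cintegral (μ := μ) (ContinuousLinearMap.lsmul ℂ ℂ ((w - z)⁻¹) : ℂ →L[ℂ] ℂ)
        ((integrable_exp hK hμ w).sub (integrable_exp hK hμ z))
      rw [slope_def_module, h1]
      exact h2
    refine Tendsto.congr (fun w => (hslope w).symm) ?_
    refine VectorMeasure.tendsto_integral_filter_of_norm_le_const ?_ ?_ ?_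
    · refine Eventually.of_forall fun w => ?_
      refine (integrable_of_continuousOn hK hμ ?_).aestronglyMeasurable
      simp only [slope_def_module]
      fun_prop
    -- By the mean value inequality, this bound for the derivative in `w` over the unit ball about
    -- `z` also dominates the difference quotients, uniformly for `ξ ∈ K`.
    · refine ⟨Real.exp ((‖z‖ + 1) * R) * R, ?_⟩
      have hball : ∀ᶠ w in 𝓝[≠] z, w ∈ Metric.ball z 1 :=
        nhdsWithin_le_nhds (Metric.ball_mem_nhds z one_pos)
      filter_upwards [hball, self_mem_nhdsWithin] with w hw hwz
      filter_upwards [hμ] with ξ hξ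
      have hξR := hR ξ hξ
      have hb : ∀ x ∈ Metric.ball z 1,
          ‖Complex.exp (-(x * ξ)) * -ξ‖ ≤ Real.exp ((‖z‖ + 1) * R) * R := by
        intro x hx
        have hx' : ‖x‖ ≤ ‖z‖ + 1 := by
          have h1 : ‖x - z‖ < 1 := by rwa [← mem_ball_iff_norm]
          have h2 := norm_le_norm_add_norm_sub' x z
          linarith
        rw [norm_mul, norm_neg]
        refine mul_le_mul ((Complex.norm_exp_le_exp_norm _).trans ?_) hξR (norm_nonneg _)
          (Real.exp_nonneg _)
        rw [norm_neg, norm_mul]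
        gcongr
      have hmv := (convex_ball z 1).norm_image_sub_le_of_norm_hasDerivWithin_le
        (fun x _ => (hderiv ξ x).hasDerivWithinAt) hb (Metric.mem_ball_self one_pos) hw
      rw [slope_def_module, norm_smul, norm_inv, inv_mul_le_iff₀ (norm_pos_iff.2 (sub_ne_zero.2 hwz))]
      rwa [mul_comm ‖w - z‖]
    · exact Eventually.of_forall fun ξ => (hasDerivAt_iff_tendsto_slope.1 (hderiv ξ z))
  exact key.differentiableAt

end FourierBorel

/-! ### The geometry of the sector -/

section Sector

variable {α : ℝ}

/-- Monotonicity of the tangent turns the condition on the argument into a linear one, from which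
openness, additivity and convexity are immediate. -/
lemma mem_sector_iff (hα : 0 < α) (hα' : α < Real.pi / 2) {z : ℂ} :
    z ∈ sector α ↔ 0 < z.re ∧ |z.im| < Real.tan α * z.re := by
  refine and_congr_right fun hz => ?_
  have harg : |z.arg| < Real.pi / 2 := Complex.abs_arg_lt_pi_div_two_iff.2 (Or.inl hz)
  have htan : |z.im| = Real.tan |z.arg| * z.re := by
    have h : Real.tan |z.arg| = |Real.tan z.arg| := by
      rcases abs_cases z.arg with ⟨h, h0⟩ | ⟨h, h0⟩
      · rw [h, abs_of_nonneg (Real.tan_nonneg_of_nonneg_of_le_pi_div_two h0 (h ▸ harg.le))]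
      · rw [h, Real.tan_neg, abs_of_nonpos
          (Real.tan_nonpos_of_nonpos_of_neg_pi_div_two_le h0.le (by linarith))]
    rw [h, Complex.tan_arg, abs_div, abs_of_pos hz, div_mul_cancel₀ _ hz.ne']
  rw [htan, mul_lt_mul_iff_left₀ hz]
  refine ⟨fun h => Real.tan_lt_tan_of_nonneg_of_lt_pi_div_two (abs_nonneg _) hα' h, fun h => ?_⟩
  by_contra! hle
  rcases hle.eq_or_lt with h' | h'
  · rw [h'] at h
    exact lt_irrefl _ h
  · exact lt_asymm h (Real.tan_lt_tan_of_nonneg_of_lt_pi_div_two hα.le harg h')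

lemma isOpen_sector (hα : 0 < α) (hα' : α < Real.pi / 2) : IsOpen (sector α) := by
  have h : sector α = {z : ℂ | 0 < z.re} ∩ {z : ℂ | |z.im| < Real.tan α * z.re} := by
    ext z
    exact mem_sector_iff hα hα'
  rw [h]
  exact (isOpen_lt continuous_const Complex.continuous_re).inter
    (isOpen_lt (by fun_prop) (by fun_prop))

lemma smul_mem_sector {t : ℝ} (ht : 0 < t) {z : ℂ} (hz : z ∈ sector α) : (t : ℂ) * z ∈ sector α := by
  refine ⟨by simpa using mul_pos ht hz.1, ?_⟩
  rw [Complex.arg_real_mul _ ht]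
  exact hz.2

lemma add_mem_sector (hα : 0 < α) (hα' : α < Real.pi / 2) {z w : ℂ} (hz : z ∈ sector α)
    (hw : w ∈ sector α) : z + w ∈ sector α := by
  rw [mem_sector_iff hα hα'] at *
  refine ⟨by simpa using add_pos hz.1 hw.1, ?_⟩
  rw [Complex.add_im, Complex.add_re, mul_add]
  exact (abs_add_le _ _).trans_lt (add_lt_add hz.2 hw.2)

lemma convex_sector (hα : 0 < α) (hα' : α < Real.pi / 2) : Convex ℝ (sector α) := by
  refine convex_iff_forall_pos.2 fun x hx y hy a b ha hb _ => ?_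
  simpa using add_mem_sector hα hα' (smul_mem_sector ha hx) (smul_mem_sector hb hy)

/-- Compactness leaves a margin between the support and the sides of the sector; the strict
inequality `κ < tan α` is what later makes room for a cone of decay. -/
lemma exists_bounds_of_isCompact (hα : 0 < α) (hα' : α < Real.pi / 2) {K : Set ℂ}
    (hK : IsCompact K) (hKα : K ⊆ sector α) :
    ∃ r κ : ℝ, 0 < r ∧ 0 ≤ κ ∧ κ < Real.tan α ∧ ∀ ξ ∈ K, r ≤ ξ.re ∧ |ξ.im| ≤ κ * ξ.re := by
  rcases K.eq_empty_or_nonempty with rfl | hne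
  · exact ⟨1, 0, one_pos, le_rfl, Real.tan_pos_of_pos_of_lt_pi_div_two hα hα', by simp⟩
  have hre : ∀ ξ ∈ K, 0 < ξ.re := fun ξ hξ => (hKα hξ).1
  obtain ⟨ξ₁, hξ₁, h₁⟩ := hK.exists_isMinOn hne Complex.continuous_re.continuousOn
  obtain ⟨ξ₂, hξ₂, h₂⟩ := hK.exists_isMaxOn (f := fun ξ : ℂ => |ξ.im| / ξ.re) hne
    (ContinuousOn.div (by fun_prop) (by fun_prop) fun ξ hξ => (hre ξ hξ).ne')
  refine ⟨ξ₁.re, |ξ₂.im| / ξ₂.re, hre _ hξ₁, div_nonneg (abs_nonneg _) (hre _ hξ₂).le, ?_,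
    fun ξ hξ => ⟨h₁ hξ, (div_le_iff₀ (hre _ hξ)).1 (h₂ hξ)⟩⟩
  exact (div_lt_iff₀ (hre _ hξ₂)).2 ((mem_sector_iff hα hα').1 (hKα hξ₂)).2

end Sector

/-! ### Lower bounds along rays -/

section LowerBound

variable {F : ℂ → ℂ}

/-- A consequence of the maximum principle: an entire function which is real on the real axis,
vanishes at `0` and is small far out in a cone about the positive axis is, on every initial segment
of a ray of the cone that is long enough, somewhere as large as on the positive axis. -/
lemma exists_le_norm_of_mem_cone (hF : Differentiable ℂ F)
    (hconj : ∀ z, F (starRingEnd ℂ z) = starRingEnd ℂ (F z)) (h0 : F 0 = 0) {k X M x₀ : ℝ}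
    (hX : 0 < X) (hM : 0 < M) (hx₀ : 0 < x₀) (hFx₀ : M ≤ ‖F x₀‖)
    (hdecay : ∀ z : ℂ, X ≤ z.re → |z.im| ≤ k * z.re → ‖F z‖ < M) {l : ℂ} (hlX : X ≤ l.re)
    (hlk : |l.im| ≤ k * l.re) : ∃ t : ℝ, 0 < t ∧ t ≤ 1 ∧ M ≤ ‖F (t * l)‖ := by
  by_contra! hcon
  -- Assuming the contrary, `‖F‖ < M` on the whole ray through `l`: up to `l` by assumption, beyond
  -- it by decay. Symmetry carries this to the conjugate ray.
  have hl : 0 < l.re := hX.trans_le hlX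
  have hray : ∀ t : ℝ, 0 < t → ‖F (t * l)‖ < M := by
    intro t ht
    rcases le_or_gt t 1 with h | h
    · exact hcon t ht h
    · refine hdecay _ ?_ ?_
      · simp only [Complex.re_ofReal_mul]
        nlinarith
      · simp only [Complex.re_ofReal_mul, Complex.im_ofReal_mul, abs_mul, abs_of_pos ht]
        nlinarith
  have hray' : ∀ t : ℝ, 0 < t → ‖F (t * starRingEnd ℂ l)‖ < M := by
    intro t ht
    have h : (t : ℂ) * starRingEnd ℂ l = starRingEnd ℂ (t * l) := by simp
    rw [h, hconj, RCLike.norm_conj]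
    exact hray t ht
  have hk : 0 ≤ k := by
    by_contra! h
    nlinarith [abs_nonneg l.im]
  have hx₀X : x₀ < X := by
    by_contra! h
    refine (hdecay x₀ (by simpa using h) ?_).not_ge hFx₀
    simpa using mul_nonneg hk hx₀.le
  -- For real `l` the triangle degenerates, but the ray is the positive axis itself and passes
  -- through `x₀`.
  rcases eq_or_ne l.im 0 with him | him
  · have h : ((x₀ / l.re : ℝ) : ℂ) * l = x₀ := by
      apply Complex.ext
      · simp [-Complex.ofReal_div, hl.ne']
      · simp [-Complex.ofReal_div, him]
    have := hray (x₀ / l.re) (div_pos hx₀ hl)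
    rw [h] at this
    exact this.not_ge hFx₀
  set q := |l.im| / l.re with hq
  have hq0 : 0 < q := div_pos (abs_pos.2 him) hl
  have hqk : q ≤ k := (div_le_iff₀ hl).2 hlk
  -- The open triangle with apex `0`, slanted sides along the two rays, and vertical side at `Re z =
  -- X`; it contains `x₀`.
  set U : Set ℂ := {z | |z.im| < q * z.re ∧ z.re < X} with hU
  have hUopen : IsOpen U :=
    (isOpen_lt (f := fun z : ℂ => |z.im|) (g := fun z => q * z.re) (by fun_prop)
      (by fun_prop)).inter (isOpen_lt Complex.continuous_re continuous_const)
  have hUcl : closure U ⊆ {z | |z.im| ≤ q * z.re ∧ z.re ≤ X} := by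
    refine closure_minimal (fun z hz => ⟨hz.1.le, hz.2.le⟩) ?_
    exact (isClosed_le (f := fun z : ℂ => |z.im|) (g := fun z => q * z.re) (by fun_prop)
      (by fun_prop)).inter (isClosed_le Complex.continuous_re continuous_const)
  have hx₀U : (x₀ : ℂ) ∈ U := ⟨by simpa using mul_pos hq0 hx₀, by simpa using hx₀X⟩
  have hUb : Bornology.IsBounded U := by
    refine isBounded_iff_forall_norm_le.2 ⟨X + q * X, fun z hz => ?_⟩
    have hre : 0 < z.re := by
      by_contra! h
      nlinarith [abs_nonneg z.im, hz.1]
    have h1 := Complex.norm_le_abs_re_add_abs_im z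
    rw [abs_of_pos hre] at h1
    have h2 : q * z.re ≤ q * X := by gcongr; exact hz.2.le
    linarith [hz.1, hz.2]
  obtain ⟨z, hzU, hmax⟩ := Complex.exists_mem_frontier_isMaxOn_norm hUb ⟨_, hx₀U⟩
    hF.diffContOnCl
  have hMz : M ≤ ‖F z‖ := hFx₀.trans (hmax (subset_closure hx₀U))
  refine absurd hMz (not_le.2 ?_)
  obtain ⟨hz1, hz2⟩ := hUcl hzU.1
  have hzre : 0 ≤ z.re := by
    by_contra! h
    nlinarith [abs_nonneg z.im]
  have hznot : z ∉ U := fun h => hzU.2 (by rwa [hUopen.interior_eq])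
  -- A frontier point is on the vertical side (decay), at the apex (`F 0 = 0`), or on one of the two
  -- rays.
  rcases hz2.eq_or_lt with hzX | hzX
  · exact hdecay z hzX.ge (hz1.trans (by gcongr))
  have hzim : |z.im| = q * z.re := by
    by_contra h
    exact hznot ⟨lt_of_le_of_ne hz1 h, hzX⟩
  rcases hzre.eq_or_lt with hz0 | hz0
  · rw [← hz0, mul_zero, abs_eq_zero] at hzim
    have : z = 0 := Complex.ext hz0.symm hzim
    rwa [this, h0, norm_zero]
  have ht : 0 < z.re / l.re := div_pos hz0 hl
  have him' : |z.im| = |z.re / l.re * l.im| := by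
    rw [hzim, abs_mul, abs_of_pos ht, hq]
    ring
  rcases abs_eq_abs.1 him' with h | h
  · have hz : z = (z.re / l.re : ℝ) * l := by
      apply Complex.ext
      · rw [Complex.re_ofReal_mul, div_mul_cancel₀ _ hl.ne']
      · rw [Complex.im_ofReal_mul, h]
    rw [hz]
    exact hray _ ht
  · have hz : z = (z.re / l.re : ℝ) * starRingEnd ℂ l := by
      apply Complex.ext
      · rw [Complex.re_ofReal_mul, Complex.conj_re, div_mul_cancel₀ _ hl.ne']
      · rw [Complex.im_ofReal_mul, Complex.conj_im, h, mul_neg]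
    rw [hz]
    exact hray' _ ht

/-- Decay confines the search to a compact interval, so the supremum is attained; vanishing at `0`
excludes the left endpoint. -/
lemma exists_forall_norm_le_norm (hF : Continuous F) (h0 : F 0 = 0)
    (hdecay : Tendsto (fun x : ℝ => F x) atTop (𝓝 0)) {x₁ : ℝ} (hx₁ : 0 < x₁) (hFx₁ : F x₁ ≠ 0) :
    ∃ x₀ : ℝ, 0 < x₀ ∧ F x₀ ≠ 0 ∧ ∀ x : ℝ, 0 < x → ‖F x‖ ≤ ‖F x₀‖ := by
  have h1 : ∀ᶠ x : ℝ in atTop, ‖F x‖ < ‖F x₁‖ := by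
    have := hdecay.norm
    rw [norm_zero] at this
    exact this.eventually_lt_const (norm_pos_iff.2 hFx₁)
  obtain ⟨X, hX⟩ := eventually_atTop.1 h1
  have hx₁X : x₁ < X := by
    by_contra! h
    exact lt_irrefl _ (hX x₁ h)
  obtain ⟨x₀, hx₀, hmax⟩ := isCompact_Icc.exists_isMaxOn (s := Icc 0 X)
    (f := fun x : ℝ => ‖F x‖) ⟨x₁, hx₁.le, hx₁X.le⟩ (by fun_prop)
  have hle : ‖F x₁‖ ≤ ‖F x₀‖ := hmax ⟨hx₁.le, hx₁X.le⟩
  have hFx₀ : F x₀ ≠ 0 := norm_pos_iff.1 ((norm_pos_iff.2 hFx₁).trans_le hle)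
  refine ⟨x₀, lt_of_le_of_ne hx₀.1 ?_, hFx₀, fun x hx => ?_⟩
  · rintro rfl
    exact hFx₀ (by simpa using h0)
  · rcases le_or_gt x X with h | h
    · exact hmax ⟨hx.le, h⟩
    · exact (hX x h.le).le.trans hle

/-- If the values of the Fourier-Borel transform on the segments `(0, t₀ λ]` stay below the supremum
on the positive axis, and `λ` ranges over a translate of a narrow enough cone, then `λ` stays
bounded. -/
lemma exists_bound_of_fourierBorel_lt {α : ℝ} (hα : 0 < α) (hα' : α < Real.pi / 2)
    {μ : ComplexMeasure ℂ} (hμ_supp : IsCompactlySupportedIn μ α) (hμ_symm : IsSymmetricMeasure μ)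
    (hμ_mass : μ univ = 0) (hpos : 0 < ⨆ x : ℝ, ⨆ _ : 0 < x, ‖fourierBorel μ x‖ₑ) :
    ∃ κ : ℝ, 0 < κ ∧ κ < Real.tan α ∧ ∀ c t₀ : ℝ, 0 < t₀ → ∃ R : ℝ, 0 < R ∧ ∀ l : ℂ,
      κ * |l.im| - c ≤ l.re →
      (∀ t : ℝ, 0 < t → t ≤ t₀ →
        ‖fourierBorel μ (t * l)‖ₑ < ⨆ x : ℝ, ⨆ _ : 0 < x, ‖fourierBorel μ x‖ₑ) → ‖l‖ ≤ R := by
  obtain ⟨K, hK, hKα, hμK⟩ := hμ_supp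
  have hae := ae_mem_of_forall_disjoint hK hμK
  obtain ⟨r, κ, hr, hκ0, hκα, hKb⟩ := exists_bounds_of_isCompact hα hα' hK hKα
  -- With `κ < κ'' < κ'`, the cone of slope `k = 1/κ''` is narrow enough for decay, since `κ k < 1`,
  -- yet wider than the cone of slope `1/κ'` containing the exponents, since `κ' k > 1`.
  obtain ⟨κ', hκκ', hκ'α⟩ := exists_between hκα
  obtain ⟨κ'', hκκ'', hκ''κ'⟩ := exists_between hκκ'
  have hκ'' : 0 < κ'' := hκ0.trans_lt hκκ''
  have hκ' : 0 < κ' := hκ0.trans_lt hκκ'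
  set k := κ''⁻¹ with hk
  have hk0 : 0 < k := inv_pos.2 hκ''
  have hkκ : 0 < 1 - κ * k := by
    rw [hk, sub_pos, ← div_eq_mul_inv, div_lt_one hκ'']
    exact hκκ''
  have hkκ' : 0 < κ' * k - 1 := by
    rw [hk, sub_pos, ← div_eq_mul_inv, one_lt_div hκ'']
    exact hκ''κ'
  set V := ‖(ContinuousLinearMap.lsmul ℝ ℂ : ℂ →L[ℝ] ℂ →L[ℝ] ℂ).flip‖ * μ.variation.real univ
    with hV
  have hbound : ∀ z : ℂ, 0 ≤ z.re → |z.im| ≤ k * z.re →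
      ‖fourierBorel μ z‖ ≤ Real.exp (-(r * ((1 - κ * k) * z.re))) * V := by
    intro z hz hzk
    refine norm_fourierBorel_le ?_
    filter_upwards [hae] with ξ hξ
    obtain ⟨h1, h2⟩ := hKb ξ hξ
    have h3 : z.im * ξ.im ≤ (k * z.re) * (κ * ξ.re) :=
      (le_abs_self _).trans (by rw [abs_mul]; exact mul_le_mul hzk h2 (abs_nonneg _) (by positivity))
    rw [Complex.mul_re]
    have h4 : r * ((1 - κ * k) * z.re) ≤ ξ.re * ((1 - κ * k) * z.re) := by gcongr
    linarith
  have htend : Tendsto (fun x : ℝ => Real.exp (-(r * ((1 - κ * k) * x))) * V) atTop (𝓝 0) := by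
    have : Tendsto (fun x : ℝ => r * ((1 - κ * k) * x)) atTop atTop :=
      (tendsto_id.const_mul_atTop hkκ).const_mul_atTop hr
    simpa using (Real.tendsto_exp_neg_atTop_nhds_zero.comp this).mul_const V
  have hF := differentiable_fourierBorel hK hae
  have hF0 := fourierBorel_zero hμ_mass
  obtain ⟨x₁, hx₁⟩ := lt_iSup_iff.1 hpos
  obtain ⟨hx₁0, hx₁⟩ := lt_iSup_iff.1 hx₁
  have hFx₁ : fourierBorel μ x₁ ≠ 0 := enorm_pos.1 hx₁
  have hdec : Tendsto (fun x : ℝ => fourierBorel μ x) atTop (𝓝 0) := by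
    refine squeeze_zero_norm' ?_ htend
    filter_upwards [eventually_ge_atTop 0] with x hx
    simpa using hbound x (by simpa using hx) (by simpa using mul_nonneg hk0.le hx)
  obtain ⟨x₀, hx₀, hFx₀, hmax⟩ := exists_forall_norm_le_norm hF.continuous hF0 hdec hx₁0 hFx₁
  have hM : 0 < ‖fourierBorel μ x₀‖ := norm_pos_iff.2 hFx₀
  obtain ⟨X, hX, hX0⟩ := ((eventually_forall_ge_atTop.2 (htend.eventually_lt_const hM)).and
    (eventually_gt_atTop 0)).exists
  have hsup : (⨆ x : ℝ, ⨆ _ : 0 < x, ‖fourierBorel μ x‖ₑ) ≤ ‖fourierBorel μ x₀‖ₑ :=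
    iSup₂_le fun x hx => enorm_le_iff_norm_le.2 (hmax x hx)
  refine ⟨κ', hκ', hκ'α, fun c t₀ ht₀ => ?_⟩
  -- Beyond the first bound `t₀ l` is in the region of decay; beyond the second the translate by `c`
  -- is absorbed and `l` lies in the cone of slope `k`.
  set B := max (X / t₀) (|c| / (κ' * k - 1)) with hB
  have hB0 : 0 < B := lt_max_of_lt_left (div_pos hX0 ht₀)
  refine ⟨B + |c| + (B + |c|) / κ', by positivity, fun l hl hlt => ?_⟩
  have hc := le_abs_self c
  have hlB : l.re ≤ B := by
    by_contra! hlB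
    have h1 : X < t₀ * l.re := by
      have := (le_max_left _ _).trans_lt hlB
      rwa [div_lt_iff₀' ht₀] at this
    have h2 : |c| < (κ' * k - 1) * l.re := by
      have := (le_max_right _ _).trans_lt hlB
      rwa [div_lt_iff₀' hkκ'] at this
    have h3 : |l.im| ≤ k * l.re := by
      have : κ' * |l.im| ≤ κ' * (k * l.re) := by linarith
      exact le_of_mul_le_mul_left this hκ'
    obtain ⟨t, ht, ht1, hle⟩ := exists_le_norm_of_mem_cone (l := t₀ * l) (k := k) hF
      (fourierBorel_conj hK hae hμ_symm) hF0 hX0 hM hx₀ le_rfl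
      (fun z hz hzk => (hbound z (hX0.le.trans hz) hzk).trans_lt (hX _ hz))
      (by simpa using h1.le) (by
        simp only [Complex.im_ofReal_mul, Complex.re_ofReal_mul, abs_mul, abs_of_pos ht₀]
        nlinarith)
    refine (hlt (t * t₀) (mul_pos ht ht₀) (mul_le_of_le_one_left ht₀.le ht1)).not_ge
      (hsup.trans ?_)
    rw [Complex.ofReal_mul, mul_assoc]
    exact enorm_le_iff_norm_le.2 hle
  have him : |l.im| ≤ (B + |c|) / κ' := by
    rw [le_div_iff₀' hκ']
    linarith
  have hre : |l.re| ≤ B + |c| := by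
    refine abs_le.2 ⟨?_, by linarith [abs_nonneg c]⟩
    nlinarith [abs_nonneg l.im]
  exact (Complex.norm_le_abs_re_add_abs_im l).trans (add_le_add hre him)

end LowerBound

/-! ### Scalar semigroups -/

lemma eq_zero_or_exists_eq_exp {α : ℝ} (hα : 0 < α) (hα' : α < Real.pi / 2) {f : ℂ → ℂ}
    (hf : DifferentiableOn ℂ f (sector α))
    (hadd : ∀ z ∈ sector α, ∀ w ∈ sector α, f (z + w) = f z * f w) :
    (∀ z ∈ sector α, f z = 0) ∨ ∃ l : ℂ, ∀ z ∈ sector α, f z = Complex.exp (-(l * z)) := by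
  by_cases h : ∀ z ∈ sector α, f z = 0
  · exact Or.inl h
  right
  push Not at h
  obtain ⟨s, hs, hfs⟩ := h
  have hopen := isOpen_sector hα hα'
  have hd : ∀ z ∈ sector α, HasDerivAt f (deriv f z) z := fun z hz =>
    (hf.differentiableAt (hopen.mem_nhds hz)).hasDerivAt
  have hadd_mem : ∀ z ∈ sector α, ∀ w ∈ sector α, z + w ∈ sector α := fun z hz w hw =>
    add_mem_sector hα hα' hz hw
  have hderiv : ∀ z ∈ sector α, ∀ w ∈ sector α, deriv f (z + w) = f z * deriv f w := by
    intro z hz w hw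
    have h1 : HasDerivAt (fun w => f (z + w)) (deriv f (z + w)) w :=
      (hd _ (hadd_mem z hz w hw)).comp_const_add z w
    have h2 : HasDerivAt (fun w => f (z + w)) (f z * deriv f w) w := by
      refine ((hd w hw).const_mul (f z)).congr_of_eventuallyEq ?_
      filter_upwards [hopen.mem_nhds hw] with v hv using hadd z hz v hv
    exact h1.unique h2
  -- Differentiating `f(s + w)` in either variable gives `f(s) f'(w) = f(w) f'(s)`, a linear
  -- equation with this constant.
  set l := -(deriv f s / f s) with hl
  have hode : ∀ w ∈ sector α, deriv f w = -l * f w := by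
    intro w hw
    have h1 := hderiv s hs w hw
    have h2 := hderiv w hw s hs
    rw [add_comm, h2] at h1
    rw [hl]
    field_simp
    linear_combination -h1
  have hconst : ∀ w ∈ sector α, f w * Complex.exp (l * w) = f s * Complex.exp (l * s) := by
    intro w hw
    refine hopen.is_const_of_deriv_eq_zero (𝕜 := ℂ) (f := fun w => f w * Complex.exp (l * w))
      (convex_sector hα hα').isPreconnected ?_ ?_ hw hs
    · exact hf.mul (by fun_prop)
    · intro z hz
      have h1 : HasDerivAt (fun w => Complex.exp (l * w)) (Complex.exp (l * z) * l) z := by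
        simpa using ((hasDerivAt_id z).const_mul l).cexp
      have h2 := ((hd z hz).mul h1).deriv
      refine h2.trans ?_
      rw [hode z hz, Pi.zero_apply]
      ring
  refine ⟨l, fun w hw => ?_⟩
  -- The constant value of `f(w) exp (l w)` equals its own square by evaluation at `2s`, and is
  -- non-zero, so it is `1`.
  have h1 := hconst (s + s) (hadd_mem s hs s hs)
  rw [hadd s hs s hs, mul_add, Complex.exp_add] at h1
  have h2 : f s * Complex.exp (l * s) = 1 :=
    mul_left_cancel₀ (mul_ne_zero hfs (Complex.exp_ne_zero (l * s))) (by linear_combination h1)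
  have h3 := (hconst w hw).trans h2
  rw [Complex.exp_neg]
  exact eq_inv_of_mul_eq_one_left h3

/-! ### Characters of commutative Banach algebras -/

section Banach

variable {C : Type*} [NormedRing C] [NormedAlgebra ℂ C] [CompleteSpace C]

lemma exists_algHom_apply_eq_zero (hc : ∀ a b : C, a * b = b * a) {a : C} (ha : ¬IsUnit a) :
    ∃ φ : C →ₐ[ℂ] ℂ, φ a = 0 := by
  let : NormedCommRing C := { ‹NormedRing C› with mul_comm := hc }
  obtain ⟨f, hf⟩ := WeakDual.CharacterSpace.exists_apply_eq_zero ha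
  exact ⟨WeakDual.CharacterSpace.equivAlgHom f, hf⟩

/-- An element `a` whose spectrum is contained in `{0} ∪ {|w - 1| ≤ 1/2}` has an inverse modulo the
characters which vanish at `a`. -/
lemma exists_mul_eq_one_of_algHom (hc : ∀ a b : C, a * b = b * a) {a : C}
    (ha : ∀ φ : C →ₐ[ℂ] ℂ, φ a = 0 ∨ ‖φ a - 1‖ ≤ 1 / 2) :
    ∃ b : C, ∀ φ : C →ₐ[ℂ] ℂ, φ a ≠ 0 → φ a * φ b = 1 := by
  have hpos : (0 : ℝ) < 3 / 4 := by norm_num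
  -- The radius `3/4` separates the disc of radius `1/2` about `1` from `0`.
  have hres : ∀ w ∈ Metric.sphere (1 : ℂ) (3 / 4), w ∈ resolventSet ℂ a := by
    intro w hw
    rw [mem_sphere_iff_norm] at hw
    by_contra h
    obtain ⟨φ, hφ⟩ := exists_algHom_apply_eq_zero hc h
    rw [map_sub, AlgHom.commutes, sub_eq_zero] at hφ
    have hφ : w = φ a := hφ
    rcases ha φ with h0 | h0
    · rw [hφ, h0] at hw
      norm_num at hw
    · rw [← hφ, hw] at h0
      norm_num at h0
  have hne : ∀ w ∈ Metric.closedBall (1 : ℂ) (3 / 4), w ≠ 0 := by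
    rintro w hw rfl
    norm_num [mem_closedBall_iff_norm] at hw
  set g : ℂ → C := fun w => w⁻¹ • resolvent a w with hg
  have hgcont : ContinuousOn g (Metric.sphere 1 (3 / 4)) := by
    intro w hw
    have h1 : ContinuousAt (resolvent a) w :=
      (spectrum.hasDerivAt_resolvent_const_left (hres w hw)).continuousAt
    exact ((continuousAt_inv₀ (hne w (Metric.sphere_subset_closedBall hw))).smul
      h1).continuousWithinAt
  have hgint : CircleIntegrable g 1 (3 / 4) := hgcont.circleIntegrable hpos.le
  -- The holomorphic functional calculus for the function equal to `1/w` near the disc and `0` near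
  -- the origin.
  refine ⟨(2 * Real.pi * Complex.I : ℂ)⁻¹ • ∮ w in C(1, 3 / 4), g w, fun φ hφ => ?_⟩
  have hφball : φ a ∈ Metric.ball (1 : ℂ) (3 / 4) := by
    rw [mem_ball_iff_norm]
    exact ((ha φ).resolve_left hφ).trans_lt (by norm_num)
  have hφint : φ (∮ w in C(1, 3 / 4), g w) = ∮ w in C(1, 3 / 4), (w - φ a)⁻¹ • w⁻¹ := by
    have h1 := φ.toContinuousLinearMap.intervalIntegral_comp_comm hgint.out
    rw [circleIntegral]
    refine (h1.symm.trans ?_ : φ.toContinuousLinearMap _ = _)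
    rw [circleIntegral]
    refine intervalIntegral.integral_congr fun θ _ => ?_
    have hθ : circleMap 1 (3 / 4) θ ∈ Metric.sphere (1 : ℂ) (3 / 4) :=
      circleMap_mem_sphere 1 hpos.le θ
    have hinv : φ (resolvent a (circleMap 1 (3 / 4) θ))
        = (circleMap 1 (3 / 4) θ - φ a)⁻¹ := by
      refine eq_inv_of_mul_eq_one_left ?_
      have h2 : φ (algebraMap ℂ C (circleMap 1 (3 / 4) θ) - a) = circleMap 1 (3 / 4) θ - φ a := by
        rw [map_sub, AlgHom.commutes]
        rfl
      rw [← h2, ← map_mul, resolvent, Ring.inverse_mul_cancel _ (hres _ hθ), map_one]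
    simp only [AlgHom.coe_toContinuousLinearMap, hg, map_smul, hinv, smul_eq_mul]
    ring
  have hcauchy := DiffContOnCl.two_pi_i_inv_smul_circleIntegral_sub_inv_smul
    (f := fun w : ℂ => w⁻¹) (c := 1) (R := 3 / 4) (w := φ a) ?_ hφball
  · rw [map_smul, hφint, hcauchy, mul_inv_cancel₀ hφ]
  · refine DifferentiableOn.diffContOnCl ?_
    rw [closure_ball _ hpos.ne']
    exact fun w hw => (differentiableAt_inv (hne w hw)).differentiableWithinAt

end Banach

/-! ### Characters of the unitization and the radical -/

section Unitization

variable {A : Type*} [NonUnitalNormedRing A] [NormedSpace ℂ A] [IsScalarTower ℂ A A]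
  [SMulCommClass ℂ A A]

omit [IsScalarTower ℂ A A] [SMulCommClass ℂ A A] in
lemma unitization_mul_comm (hc : ∀ a b : A, a * b = b * a) (u v : Unitization ℂ A) :
    u * v = v * u := by
  ext
  · simp [mul_comm]
  · simp [hc u.snd v.snd, add_comm]

lemma unitizationL1_mul_comm (hc : ∀ a b : A, a * b = b * a) (u v : WithLp 1 (Unitization ℂ A)) :
    u * v = v * u := by
  let e := WithLp.unitizationAlgEquiv (𝕜 := ℂ) (A := A) ℂ
  refine e.injective ?_
  rw [map_mul, map_mul, unitization_mul_comm hc]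

lemma exists_unitization_algHom_apply_eq_zero [CompleteSpace A] (hc : ∀ a b : A, a * b = b * a)
    {u : Unitization ℂ A} (hu : ¬IsUnit u) : ∃ φ : Unitization ℂ A →ₐ[ℂ] ℂ, φ u = 0 := by
  let e := WithLp.unitizationAlgEquiv (𝕜 := ℂ) (A := A) ℂ
  have hu' : ¬IsUnit (e.symm u) := by
    rwa [MulEquiv.isUnit_map]
  obtain ⟨φ, hφ⟩ := exists_algHom_apply_eq_zero (unitizationL1_mul_comm hc) hu'
  exact ⟨φ.comp e.symm, hφ⟩

lemma norm_algHom_apply_inr_le [CompleteSpace A] (φ : Unitization ℂ A →ₐ[ℂ] ℂ) (a : A) :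
    ‖φ a‖ ≤ ‖a‖ := by
  let e := WithLp.unitizationAlgEquiv (𝕜 := ℂ) (A := A) ℂ
  have h := AlgHom.norm_apply_le_self_mul_norm_one (φ.comp (e : _ →ₐ[ℂ] Unitization ℂ A))
    (WithLp.toLp 1 (a : Unitization ℂ A))
  have h1 : ‖(1 : WithLp 1 (Unitization ℂ A))‖ = 1 := by
    rw [WithLp.unitization_norm_def]
    change ‖(1 : Unitization ℂ A).fst‖ + ‖(1 : Unitization ℂ A).snd‖ = 1
    simp
  rwa [h1, mul_one, WithLp.unitization_norm_inr] at h

/-- The restriction of a character of the unitization to the algebra. -/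
def restrictCharacter [CompleteSpace A] (φ : Unitization ℂ A →ₐ[ℂ] ℂ) : A →L[ℂ] ℂ :=
  LinearMap.mkContinuous (φ.toLinearMap ∘ₗ Unitization.inrHom ℂ ℂ A) 1 fun a => by
    rw [one_mul]
    exact norm_algHom_apply_inr_le φ a

lemma restrictCharacter_apply [CompleteSpace A] (φ : Unitization ℂ A →ₐ[ℂ] ℂ) (a : A) :
    restrictCharacter φ a = φ a := rfl

lemma restrictCharacter_mul [CompleteSpace A] (φ : Unitization ℂ A →ₐ[ℂ] ℂ) (a b : A) :
    restrictCharacter φ (a * b) = restrictCharacter φ a * restrictCharacter φ b := by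
  rw [restrictCharacter_apply, Unitization.inr_mul, map_mul]
  rfl

lemma mem_radical_iff_forall_algHom [CompleteSpace A] (hc : ∀ a b : A, a * b = b * a) {a : A} :
    a ∈ radical A ↔ ∀ φ : Unitization ℂ A →ₐ[ℂ] ℂ, restrictCharacter φ a = 0 := by
  rw [mem_radical]
  simp only [Ring.jacobson, Module.jacobson, Submodule.mem_sInf, mem_ofPred_eq]
  constructor
  · intro h φ
    have hsurj : Function.Surjective φ := fun z => ⟨algebraMap ℂ _ z, by simp⟩
    exact h _ (RingHom.ker_isMaximal_of_surjective φ hsurj).out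
  · intro h m hm
    have hm : Ideal.IsMaximal m := ⟨hm⟩
    by_contra ha
    obtain ⟨y, hy⟩ := hm.exists_inv ha
    obtain ⟨i, hi, hyi⟩ := hy
    -- All characters vanish at `a`, so they all take the value `1` at `i = 1 - y a`; an element
    -- annihilated by no character is invertible.
    have hunit : IsUnit i := by
      by_contra hni
      obtain ⟨φ, hφ⟩ := exists_unitization_algHom_apply_eq_zero hc hni
      have h1 := congrArg φ hyi
      have h2 : φ a = 0 := h φ
      rw [map_add, map_mul, h2, hφ, mul_zero, zero_add, map_one] at h1
      exact zero_ne_one h1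
    exact hm.ne_top (Ideal.eq_top_of_isUnit_mem _ hi hunit)

lemma exists_restrictCharacter_mul_eq_one [CompleteSpace A] (hc : ∀ a b : A, a * b = b * a) {a : A}
    (ha : ∀ φ : Unitization ℂ A →ₐ[ℂ] ℂ,
      restrictCharacter φ a = 0 ∨ ‖restrictCharacter φ a - 1‖ ≤ 1 / 2) :
    ∃ b : A, ∀ φ : Unitization ℂ A →ₐ[ℂ] ℂ, restrictCharacter φ a ≠ 0 →
      restrictCharacter φ a * restrictCharacter φ b = 1 := by
  let e := WithLp.unitizationAlgEquiv (𝕜 := ℂ) (A := A) ℂ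
  obtain ⟨b, hb⟩ := exists_mul_eq_one_of_algHom (unitizationL1_mul_comm hc)
    (a := e.symm (a : Unitization ℂ A))
    (fun φ => by
      have h := ha (φ.comp e.symm.toAlgHom)
      exact h)
  -- The inverse `e b` may have a scalar part. Multiplication by `a` brings it into the ideal `A`,
  -- and `φ(a) φ(u) = (φ(a) φ(e b))² = 1`.
  set u : Unitization ℂ A := a * (e b * e b) with hu
  have hu' : ((u.snd : A) : Unitization ℂ A) = u := by
    ext <;> simp [hu]
  refine ⟨u.snd, fun φ hφ => ?_⟩
  have h := hb (φ.comp (e : _ →ₐ[ℂ] Unitization ℂ A)) (by simpa [restrictCharacter_apply] using hφ)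
  have h : φ a * φ (e b) = 1 := by simpa using h
  rw [restrictCharacter_apply, restrictCharacter_apply, hu', hu, map_mul, map_mul]
  linear_combination (φ a * φ (e b) + 1) * h

end Unitization

/-! ### Multiplication in the quotient by the radical -/

section Quotient

variable {A : Type*} [NonUnitalNormedRing A] [NormedSpace ℂ A] [IsScalarTower ℂ A A]
  [SMulCommClass ℂ A A] [CompleteSpace A]

lemma norm_mk_mul_le (a : A) (x : A ⧸ radical A) :
    ‖(Submodule.Quotient.mk a : A ⧸ radical A) * x‖ ≤ ‖a‖ * ‖x‖ := by
  refine le_of_forall_pos_le_add fun ε hε => ?_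
  obtain ⟨b, rfl, hb⟩ := Submodule.Quotient.norm_mk_lt x
    (show 0 < ε / (‖a‖ + 1) by positivity)
  rw [← mk_mul]
  calc _ ≤ ‖a * b‖ := Submodule.Quotient.norm_mk_le _ _
    _ ≤ ‖a‖ * ‖b‖ := norm_mul_le _ _
    _ ≤ ‖a‖ * (‖(Submodule.Quotient.mk b : A ⧸ radical A)‖ + ε / (‖a‖ + 1)) := by gcongr
    _ = ‖a‖ * ‖(Submodule.Quotient.mk b : A ⧸ radical A)‖ + ‖a‖ / (‖a‖ + 1) * ε := by ring
    _ ≤ _ := by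
      gcongr
      exact mul_le_of_le_one_left hε.le ((div_le_one (by positivity)).2 (by linarith))

/-- Multiplication of a fixed element of the quotient by elements of the algebra. -/
def mkMulCLM (x : A ⧸ radical A) : A →L[ℂ] A ⧸ radical A :=
  LinearMap.mkContinuous
    (LinearMap.mulRight ℂ x ∘ₗ (radical A).mkQ) ‖x‖ fun a => by
      rw [mul_comm]
      exact norm_mk_mul_le a x

lemma mkMulCLM_apply (x : A ⧸ radical A) (a : A) :
    mkMulCLM x a = Submodule.Quotient.mk a * x := rfl

lemma mk_eq_mk_iff_forall_algHom (hc : ∀ a b : A, a * b = b * a) {a b : A} :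
    (Submodule.Quotient.mk a : A ⧸ radical A) = Submodule.Quotient.mk b ↔
      ∀ φ : Unitization ℂ A →ₐ[ℂ] ℂ, restrictCharacter φ a = restrictCharacter φ b := by
  rw [Submodule.Quotient.eq, mem_radical_iff_forall_algHom hc]
  simp only [map_sub, sub_eq_zero]

end Quotient

/-! ### Semigroups in commutative Banach algebras -/

section Semigroup

variable {A : Type*} [NonUnitalNormedRing A] [NormedSpace ℂ A] [IsScalarTower ℂ A A]
  [SMulCommClass ℂ A A] [CompleteSpace A]

/-- If the exponents of the scalar semigroups `φ ∘ S`, `φ` a character, are bounded, then modulo the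
radical the algebra generated by `S` has an identity `e`, and `S` has a derivative `d` at `0`. -/
lemma exists_one_and_derivative {α : ℝ} (hα : 0 < α) (hα' : α < Real.pi / 2)
    (hc : ∀ a b : A, a * b = b * a) {S : ℂ → A}
    (hadd : ∀ z ∈ sector α, ∀ w ∈ sector α, S (z + w) = S z * S w)
    (hdiff : DifferentiableOn ℂ S (sector α))
    (hgen : ∀ φ : Unitization ℂ A →ₐ[ℂ] ℂ, (∀ z ∈ sector α, restrictCharacter φ (S z) = 0) →
      ∀ a, restrictCharacter φ a = 0)
    (hne : ∃ φ : Unitization ℂ A →ₐ[ℂ] ℂ, ∃ z ∈ sector α, restrictCharacter φ (S z) ≠ 0) {R : ℝ}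
    (hR0 : 0 < R) (hR : ∀ (φ : Unitization ℂ A →ₐ[ℂ] ℂ) (l : ℂ),
      (∀ z ∈ sector α, restrictCharacter φ (S z) = Complex.exp (-(l * z))) → ‖l‖ ≤ R) :
    ∃ e d : A, (Submodule.Quotient.mk e : A ⧸ radical A) ≠ 0 ∧
      (∀ x : A ⧸ radical A, Submodule.Quotient.mk e * x = x) ∧
      ∀ x : A ⧸ radical A, Tendsto
        (fun t : Ioi (0 : ℝ) => (((t : ℝ) : ℂ)⁻¹) • (Submodule.Quotient.mk (S (t : ℝ)) * x - x))
        (comap Subtype.val (𝓝 (0 : ℝ))) (𝓝 (Submodule.Quotient.mk d * x)) := by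
  have hcases : ∀ φ : Unitization ℂ A →ₐ[ℂ] ℂ, (∀ a, restrictCharacter φ a = 0) ∨
      ∃ l : ℂ, ‖l‖ ≤ R ∧ ∀ z ∈ sector α, restrictCharacter φ (S z) = Complex.exp (-(l * z)) := by
    intro φ
    rcases eq_zero_or_exists_eq_exp hα hα' (f := fun z => restrictCharacter φ (S z))
      ((restrictCharacter φ).differentiable.comp_differentiableOn hdiff)
      (fun z hz w hw => by rw [hadd z hz w hw, restrictCharacter_mul]) with h | ⟨l, hl⟩
    · exact Or.inl (hgen φ h)
    · exact Or.inr ⟨l, hR φ l hl, hl⟩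
  -- Then `‖l s‖ ≤ 1/4`, and `‖exp u - 1‖ ≤ 2 ‖u‖` puts `φ(S s)` within `1/2` of `1`.
  set s : ℝ := 1 / (4 * R) with hs
  have hs0 : 0 < s := by positivity
  have hsmem : (s : ℂ) ∈ sector α := ofReal_mem_sector hα hs0
  obtain ⟨b, hb⟩ := exists_restrictCharacter_mul_eq_one hc (a := S s) (fun φ => by
    rcases hcases φ with h | ⟨l, hlR, hl⟩
    · exact Or.inl (h _)
    · right
      have h1 : ‖-(l * s)‖ ≤ 1 / 4 := by
        rw [norm_neg, norm_mul, Complex.norm_real, Real.norm_of_nonneg hs0.le]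
        calc ‖l‖ * s ≤ R * s := by gcongr
          _ = 1 / 4 := by rw [hs]; field_simp
      rw [hl _ hsmem]
      refine (Complex.norm_exp_sub_one_le (h1.trans (by norm_num))).trans ?_
      linarith)
  have hone : ∀ φ : Unitization ℂ A →ₐ[ℂ] ℂ, (∀ a, restrictCharacter φ a = 0) ∨
      restrictCharacter φ (S s * b) = 1 := by
    intro φ
    rcases hcases φ with h | ⟨l, -, hl⟩
    · exact Or.inl h
    · right
      rw [restrictCharacter_mul]
      refine hb φ ?_
      rw [hl _ hsmem]
      exact Complex.exp_ne_zero _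
  have hid : ∀ x : A ⧸ radical A, Submodule.Quotient.mk (S s * b) * x = x := by
    intro x
    obtain ⟨a, rfl⟩ := Submodule.Quotient.mk_surjective _ x
    rw [← mk_mul, mk_eq_mk_iff_forall_algHom hc]
    intro φ
    rw [restrictCharacter_mul]
    rcases hone φ with h | h
    · rw [h, h, zero_mul]
    · rw [h, one_mul]
  have hDS : HasDerivAt S (deriv S s) s :=
    (hdiff.differentiableAt ((isOpen_sector hα hα').mem_nhds hsmem)).hasDerivAt
  refine ⟨S s * b, deriv S s * b, ?_, hid, fun x => ?_⟩
  · intro h0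
    obtain ⟨φ, z, hz, hφ⟩ := hne
    rw [← Submodule.Quotient.mk_zero, mk_eq_mk_iff_forall_algHom hc] at h0
    rcases hone φ with h | h
    · exact hφ (h _)
    · exact one_ne_zero (h.symm.trans ((h0 φ).trans (map_zero _)))
  · have htend : Tendsto (fun t : Ioi (0 : ℝ) => ((t : ℝ) : ℂ)) (comap Subtype.val (𝓝 (0 : ℝ)))
        (𝓝[≠] 0) := by
      refine tendsto_nhdsWithin_iff.2 ⟨?_, Eventually.of_forall fun t => ?_⟩
      · have h := Complex.continuous_ofReal.tendsto 0
        rw [Complex.ofReal_zero] at h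
        exact h.comp tendsto_comap
      · simpa using (ne_of_gt t.2 : (t : ℝ) ≠ 0)
    -- Since `S(s) b` acts as the identity, `S(t) x - x = (S(s + t) - S(s)) b x`. The limit at `0`
    -- thus becomes a derivative at the interior point `s`.
    have hslope := (hasDerivAt_iff_tendsto_slope_zero.1 hDS).comp htend
    have hlim := ((mkMulCLM x).continuous.tendsto _).comp (hslope.mul_const b)
    refine hlim.congr fun t => ?_
    have ht : ((t : ℝ) : ℂ) ∈ sector α := ofReal_mem_sector hα t.2
    simp only [Function.comp_apply, mkMulCLM_apply]
    rw [smul_mul_assoc, Submodule.Quotient.mk_smul, smul_mul_assoc, sub_mul,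
      Submodule.Quotient.mk_sub, sub_mul, hid x, add_comm, hadd _ ht _ hsmem, mul_assoc, mk_mul,
      mul_assoc, hid x]

end Semigroup

/-! ### The algebra generated by an analytic semigroup -/

section SemigroupAlgebra

variable {B : Type*} [NormedRing B] [NormedAlgebra ℂ B] {α : ℝ} {T : ℂ → B}

lemma isClosed_semigroupAlgebra : IsClosed (semigroupAlgebra α T : Set B) :=
  NonUnitalSubalgebra.isClosed_topologicalClosure _

lemma semigroupAlgebra_mul_comm (hT : IsAnalyticSemigroup α T) (a b : semigroupAlgebra α T) :
    a * b = b * a := by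
  have hcomm : ∀ x ∈ T '' sector α, ∀ y ∈ T '' sector α, x * y = y * x := by
    rintro _ ⟨z, hz, rfl⟩ _ ⟨w, hw, rfl⟩
    rw [← hT.map_add z hz w hw, ← hT.map_add w hw z hz, add_comm]
  have h := NonUnitalAlgebra.isMulCommutative_adjoin ℂ hcomm
  exact (NonUnitalSubalgebra.nonUnitalCommRingTopologicalClosure
    (NonUnitalAlgebra.adjoin ℂ (T '' sector α)) fun x y => h.is_comm.comm x y).mul_comm a b

open Classical in
/-- The semigroup as a map into the algebra which it generates, extended by `0`. -/
def semigroupMap (α : ℝ) (T : ℂ → B) (z : ℂ) : semigroupAlgebra α T :=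
  if hz : z ∈ sector α then ⟨T z, mem_semigroupAlgebra T hz⟩ else 0

lemma coe_semigroupMap {z : ℂ} (hz : z ∈ sector α) : (semigroupMap α T z : B) = T z := by
  rw [semigroupMap, dif_pos hz]

lemma semigroupMap_add (hα : 0 < α) (hα' : α < Real.pi / 2) (hT : IsAnalyticSemigroup α T)
    {z : ℂ} (hz : z ∈ sector α) {w : ℂ} (hw : w ∈ sector α) :
    semigroupMap α T (z + w) = semigroupMap α T z * semigroupMap α T w := by
  refine Subtype.ext ?_
  rw [coe_semigroupMap (add_mem_sector hα hα' hz hw)]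
  change _ = (semigroupMap α T z : B) * (semigroupMap α T w : B)
  rw [coe_semigroupMap hz, coe_semigroupMap hw, hT.map_add z hz w hw]

/-- The difference quotients lie in a closed subalgebra, hence so does their limit in `B`. -/
lemma differentiableOn_semigroupMap (hα : 0 < α) (hα' : α < Real.pi / 2)
    (hT : IsAnalyticSemigroup α T) : DifferentiableOn ℂ (semigroupMap α T) (sector α) := by
  intro z hz
  have hopen := isOpen_sector hα hα'
  have h1 := (hT.differentiableOn.differentiableAt (hopen.mem_nhds hz)).hasDerivAt
  have h2 : HasDerivAt (fun w => (semigroupMap α T w : B)) (deriv T z) z := by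
    refine h1.congr_of_eventuallyEq ?_
    filter_upwards [hopen.mem_nhds hz] with w hw using coe_semigroupMap hw
  have h3 : Tendsto (fun w => ((slope (semigroupMap α T) z w : semigroupAlgebra α T) : B)) (𝓝[≠] z)
      (𝓝 (deriv T z)) := hasDerivAt_iff_tendsto_slope.1 h2
  have hmem : deriv T z ∈ semigroupAlgebra α T :=
    isClosed_semigroupAlgebra.mem_of_tendsto h3 (Eventually.of_forall fun w => Subtype.coe_prop _)
  have h4 : HasDerivAt (semigroupMap α T) ⟨deriv T z, hmem⟩ z :=
    hasDerivAt_iff_tendsto_slope.2 (tendsto_subtype_rng.2 h3)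
  exact h4.differentiableAt.differentiableWithinAt

/-- The inclusion of the algebra generated by the semigroup. -/
def semigroupAlgebraInclusion (α : ℝ) (T : ℂ → B) : semigroupAlgebra α T →L[ℂ] B where
  toFun a := a
  map_add' _ _ := rfl
  map_smul' _ _ := rfl
  cont := continuous_subtype_val

variable [CompleteSpace B]

lemma restrictCharacter_eq_zero (φ : Unitization ℂ (semigroupAlgebra α T) →ₐ[ℂ] ℂ)
    (h : ∀ z ∈ sector α, restrictCharacter φ (semigroupMap α T z) = 0)
    (a : semigroupAlgebra α T) : restrictCharacter φ a = 0 := by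
  have hle : NonUnitalAlgebra.adjoin ℂ (T '' sector α) ≤ semigroupAlgebra α T :=
    NonUnitalSubalgebra.le_topologicalClosure _
  have h1 : ∀ x (hx : x ∈ NonUnitalAlgebra.adjoin ℂ (T '' sector α)),
      restrictCharacter φ ⟨x, hle hx⟩ = 0 := by
    intro x hx
    induction hx using NonUnitalAlgebra.adjoin_induction with
    | mem x hx =>
      obtain ⟨z, hz, rfl⟩ := hx
      rw [← h z hz]
      congr 1
      exact Subtype.ext (coe_semigroupMap hz).symm
    | add x y hx hy ihx ihy =>
      have := map_add (restrictCharacter φ) ⟨x, hle hx⟩ ⟨y, hle hy⟩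
      rw [ihx, ihy, add_zero] at this
      exact this
    | zero => exact map_zero (restrictCharacter φ)
    | mul x y hx hy ihx ihy =>
      have := restrictCharacter_mul φ ⟨x, hle hx⟩ ⟨y, hle hy⟩
      rw [ihx, zero_mul] at this
      exact this
    | smul r x hx ihx =>
      have := map_smul (restrictCharacter φ) r ⟨x, hle hx⟩
      rw [ihx, smul_zero] at this
      exact this
  obtain ⟨x, hx, hxa⟩ := mem_closure_iff_seq_limit.1
    (show (a : B) ∈ closure (NonUnitalAlgebra.adjoin ℂ (T '' sector α) : Set B) from a.2)
  have h2 : Tendsto (fun n => (⟨x n, hle (hx n)⟩ : semigroupAlgebra α T)) atTop (𝓝 a) :=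
    tendsto_subtype_rng.2 hxa
  have h3 := ((restrictCharacter φ).continuous.tendsto a).comp h2
  refine tendsto_nhds_unique h3 (tendsto_const_nhds.congr fun n => ?_)
  exact (h1 _ (hx n)).symm

/-- The spectral radius is taken in `B`, but Gelfand's formula only involves norms of powers, which
are the same in the subalgebra. -/
lemma enorm_restrictCharacter_le_spectralRadius
    (φ : Unitization ℂ (semigroupAlgebra α T) →ₐ[ℂ] ℂ) (a : semigroupAlgebra α T) :
    ‖restrictCharacter φ a‖ₑ ≤ spectralRadius ℂ (a : B) := by
  -- Exponents start at `1` because the subalgebra need not contain the identity.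
  have hpow : ∀ n : ℕ, ∃ y : semigroupAlgebra α T, (y : B) = (a : B) ^ (n + 1) ∧
      restrictCharacter φ y = restrictCharacter φ a ^ (n + 1) := by
    intro n
    induction n with
    | zero => exact ⟨a, by simp, by simp⟩
    | succ n ih =>
      obtain ⟨y, hy, hφy⟩ := ih
      refine ⟨y * a, ?_, ?_⟩
      · rw [pow_succ, ← hy]
        rfl
      · rw [restrictCharacter_mul, hφy, ← pow_succ]
  refine ge_of_tendsto (spectrum.pow_nnnorm_pow_one_div_tendsto_nhds_spectralRadius (a : B)) ?_
  filter_upwards [eventually_gt_atTop 0] with n hn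
  obtain ⟨m, rfl⟩ := Nat.exists_eq_succ_of_ne_zero hn.ne'
  obtain ⟨y, hy, hφy⟩ := hpow m
  rw [one_div, ENNReal.le_rpow_inv_iff (by positivity), ENNReal.rpow_natCast, ← enorm_pow, ← hφy,
    Nat.succ_eq_add_one, ← hy]
  exact enorm_le_iff_norm_le.2 (norm_algHom_apply_inr_le φ y)

/-- Homomorphisms shrink spectra, so a non-zero spectral value of `a` in `B` persists in the
unitization, where it is the value of a character at `a`. -/
lemma exists_restrictCharacter_ne_zero (hT : IsAnalyticSemigroup α T)
    {a : semigroupAlgebra α T} (ha : spectralRadius ℂ (a : B) ≠ 0) :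
    ∃ φ : Unitization ℂ (semigroupAlgebra α T) →ₐ[ℂ] ℂ, restrictCharacter φ a ≠ 0 := by
  obtain ⟨k, hk, hk0⟩ : ∃ k ∈ spectrum ℂ (a : B), k ≠ 0 := by
    by_contra! h
    refine ha ?_
    rw [spectralRadius]
    refine le_antisymm (iSup₂_le fun k hk => ?_) bot_le
    simp [h k hk]
  let ι : semigroupAlgebra α T →ₙₐ[ℂ] B :=
    { semigroupAlgebraInclusion α T with
      map_zero' := rfl
      map_mul' := fun _ _ => rfl }
  have hι : Unitization.lift ι (a : Unitization ℂ (semigroupAlgebra α T)) = (a : B) := by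
    simp [ι, semigroupAlgebraInclusion]
  rw [← hι] at hk
  have hk' := AlgHom.spectrum_apply_subset (Unitization.lift ι) _ hk
  obtain ⟨φ, hφ⟩ := exists_unitization_algHom_apply_eq_zero (semigroupAlgebra_mul_comm hT) hk'
  refine ⟨φ, ?_⟩
  rw [map_sub, AlgHom.commutes, sub_eq_zero] at hφ
  rw [restrictCharacter_apply, ← hφ]
  exact hk0

end SemigroupAlgebra

section SemigroupAlgebra

variable {B : Type*} [NormedRing B] [NormedAlgebra ℂ B] [CompleteSpace B] {α : ℝ} {T : ℂ → B}

/-- If `φ ∘ T` is the scalar semigroup with exponent `l`, then `|F(t l)| ≤ ρ(F(-tA))`. -/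
lemma enorm_fourierBorel_le_spectralRadius (hα : 0 < α) (hα' : α < Real.pi / 2)
    {μ : ComplexMeasure ℂ} (hμ_supp : IsCompactlySupportedIn μ α) (hT : IsAnalyticSemigroup α T)
    (φ : Unitization ℂ (semigroupAlgebra α T) →ₐ[ℂ] ℂ) {l : ℂ}
    (hl : ∀ z ∈ sector α, restrictCharacter φ (semigroupMap α T z) = Complex.exp (-(l * z)))
    {t : ℝ} (ht : 0 < t) :
    ‖fourierBorel μ (t * l)‖ₑ ≤ spectralRadius ℂ (functionalCalculus μ T t) := by
  obtain ⟨K, hK, hKα, hμK⟩ := hμ_supp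
  have hae := ae_mem_of_forall_disjoint hK hμK
  have hint : Integrable (fun ξ : ℂ => semigroupMap α T (t * ξ)) μ.variation := by
    refine integrable_of_continuousOn hK hae ?_
    exact (differentiableOn_semigroupMap hα hα' hT).continuousOn.comp (by fun_prop)
      fun ξ hξ => smul_mem_sector ht (hKα hξ)
  -- The integral is formed inside the subalgebra, so that both the inclusion into `B` and the
  -- character can be moved under it.
  have h1 : ((cintegral μ fun ξ : ℂ => semigroupMap α T (t * ξ) : semigroupAlgebra α T) : B)
      = functionalCalculus μ T t := by
    refine (map_cintegral (semigroupAlgebraInclusion α T) hint).trans ?_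
    refine VectorMeasure.integral_congr_ae ?_
    filter_upwards [hae] with ξ hξ using coe_semigroupMap (smul_mem_sector ht (hKα hξ))
  have h2 : restrictCharacter φ (cintegral μ fun ξ : ℂ => semigroupMap α T (t * ξ))
      = fourierBorel μ (t * l) := by
    refine (map_cintegral (restrictCharacter φ) hint).trans ?_
    refine VectorMeasure.integral_congr_ae ?_
    filter_upwards [hae] with ξ hξ
    rw [hl _ (smul_mem_sector ht (hKα hξ))]
    congr 1
    ring
  rw [← h1, ← h2]
  exact enorm_restrictCharacter_le_spectralRadius φ _

/-- The exponents of the scalar semigroups `φ ∘ T`, `φ` a character, lie in a translate of a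
cone. -/
lemma exists_le_re_of_restrictCharacter_eq_exp (hα : 0 < α) (hα' : α < Real.pi / 2) (T : ℂ → B)
    {κ : ℝ} (hκ : 0 < κ) (hκα : κ < Real.tan α) :
    ∃ c : ℝ, ∀ (φ : Unitization ℂ (semigroupAlgebra α T) →ₐ[ℂ] ℂ) (l : ℂ),
      (∀ z ∈ sector α, restrictCharacter φ (semigroupMap α T z) = Complex.exp (-(l * z))) →
      κ * |l.im| - c ≤ l.re := by
  have hmem : ∀ ε : ℝ, |ε| ≤ κ → (⟨1, ε⟩ : ℂ) ∈ sector α := fun ε hε =>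
    (mem_sector_iff hα hα').2 ⟨one_pos, by simpa using hε.trans_lt hκα⟩
  refine ⟨max ‖T ⟨1, κ⟩‖ ‖T ⟨1, -κ⟩‖, fun φ l hl => ?_⟩
  -- From `exp (ε Im l - Re l) = |φ(T(1 + iε))| ≤ ‖T(1 + iε)‖` and `x + 1 ≤ exp x`; the choices `ε =
  -- ±κ` give `κ |Im l|`.
  have key : ∀ ε : ℝ, |ε| ≤ κ → ε * l.im - ‖T ⟨1, ε⟩‖ ≤ l.re := by
    intro ε hε
    have h1 := norm_algHom_apply_inr_le φ (semigroupMap α T ⟨1, ε⟩)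
    rw [← restrictCharacter_apply, hl _ (hmem ε hε), Complex.norm_exp] at h1
    have h2 : ‖semigroupMap α T ⟨1, ε⟩‖ = ‖T ⟨1, ε⟩‖ := by
      rw [← coe_semigroupMap (T := T) (hmem ε hε)]
      rfl
    have h3 := Real.add_one_le_exp (-(l * ⟨1, ε⟩)).re
    have h4 : (-(l * ⟨1, ε⟩)).re = ε * l.im - l.re := by
      simp
      ring
    rw [h4] at h1 h3
    linarith
  have h1 := key κ (abs_of_pos hκ).le
  have h2 := key (-κ) (by rw [abs_neg, abs_of_pos hκ])
  rcases abs_cases l.im with ⟨h, -⟩ | ⟨h, -⟩ <;> rw [h]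
  · linarith [le_max_left ‖T ⟨1, κ⟩‖ ‖T ⟨1, -κ⟩‖]
  · linarith [le_max_right ‖T ⟨1, κ⟩‖ ‖T ⟨1, -κ⟩‖]

end SemigroupAlgebra

lemma isBoundedOperator_generator {E : Type*} [NormedAddCommGroup E] [NormedSpace ℂ E]
    {U : Ioi (0 : ℝ) → E →ₗ[ℂ] E} (G : E → E) {C : ℝ} (hG : ∀ x, HasGeneratorValue U x (G x))
    (hC : ∀ x, ‖G x‖ ≤ C * ‖x‖) : IsBoundedOperator (generator U) := by
  refine ⟨eq_top_iff.2 fun x _ => ⟨G x, hG x⟩, C, fun x => ?_⟩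
  have h : generator U x = G x := x.2.choose_spec.unique (hG x)
  rw [h]
  exact hC x

end SectorSemigroup

end

theorem mainTheorem3 {B : Type*} [NormedRing B] [NormedAlgebra ℂ B] [CompleteSpace B]
    (α : ℝ) (hα : 0 < α) (hα' : α < Real.pi / 2)
    (μ : MeasureTheory.ComplexMeasure ℂ)
    (hμ_supp : SectorSemigroup.IsCompactlySupportedIn μ α)
    (hμ_symm : SectorSemigroup.IsSymmetricMeasure μ)
    (hμ_mass : μ Set.univ = 0)
    (T : ℂ → B) (hT : SectorSemigroup.IsAnalyticSemigroup α T)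
    (hT_nq : ¬ SectorSemigroup.IsQuasinilpotentSemigroup α T)
    (t₀ : ℝ) (ht₀ : 0 < t₀)
    (h : ∀ t : ℝ, 0 < t → t ≤ t₀ →
      spectralRadius ℂ (SectorSemigroup.functionalCalculus μ T t) <
        ⨆ x : ℝ, ⨆ _ : 0 < x, ‖SectorSemigroup.fourierBorel μ x‖ₑ) :
    SectorSemigroup.IsUnital
        (SectorSemigroup.semigroupAlgebra α T ⧸
          SectorSemigroup.radical (SectorSemigroup.semigroupAlgebra α T)) ∧
      SectorSemigroup.IsBoundedOperator
        (SectorSemigroup.generator (SectorSemigroup.quotientSemigroup hα T)) := by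
  open SectorSemigroup in
  have hc := semigroupAlgebra_mul_comm hT
  -- The strict inequality at `t₀` already makes the supremum positive.
  obtain ⟨κ, hκ, hκα, hbound⟩ := exists_bound_of_fourierBorel_lt hα hα' hμ_supp hμ_symm hμ_mass
    (bot_le.trans_lt (h t₀ ht₀ le_rfl))
  obtain ⟨c, hcone⟩ := exists_le_re_of_restrictCharacter_eq_exp hα hα' T hκ hκα
  obtain ⟨R, hR0, hR⟩ := hbound c t₀ ht₀
  have hne : ∃ φ : Unitization ℂ (semigroupAlgebra α T) →ₐ[ℂ] ℂ, ∃ z ∈ sector α,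
      restrictCharacter φ (semigroupMap α T z) ≠ 0 := by
    rw [IsQuasinilpotentSemigroup] at hT_nq
    push Not at hT_nq
    obtain ⟨z, hz, hρ⟩ := hT_nq
    rw [← coe_semigroupMap (T := T) hz] at hρ
    obtain ⟨φ, hφ⟩ := exists_restrictCharacter_ne_zero hT hρ
    exact ⟨φ, z, hz, hφ⟩
  obtain ⟨e, d, he0, he, hd⟩ := exists_one_and_derivative hα hα' hc
    (fun z hz w hw => semigroupMap_add hα hα' hT hz hw) (differentiableOn_semigroupMap hα hα' hT)
    restrictCharacter_eq_zero hne hR0 fun φ l hl => hR l (hcone φ l hl) fun t ht htt₀ =>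
      (enorm_fourierBorel_le_spectralRadius hα hα' hμ_supp hT φ hl ht).trans_lt (h t ht htt₀)
  refine ⟨⟨_, he0, fun x => ⟨he x, ?_⟩⟩, isBoundedOperator_generator _ (fun x => ?_)
    (norm_mk_mul_le d)⟩
  · obtain ⟨a, rfl⟩ := Submodule.Quotient.mk_surjective _ x
    rw [← mk_mul, hc, mk_mul, he]
  · refine (hd x).congr fun t => ?_
    have ht : semigroupMap α T (t : ℝ) = semigroupElement hα T t :=
      Subtype.ext (coe_semigroupMap (ofReal_mem_sector hα t.2))
    rw [ht]
    rfl
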